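/- Let $F$ be a non-archimedean local field of odd residual characteristic, let $E/F$ be a field extension with $[E:F]\le 2$, and let $\tau$ be the generator of $\mathrm{Gal}(E/F)$ (so $\tau=1$ if $E=F$). Let $V$ be a finite-dimensional $E$-vector space with a non-degenerate $\epsilon$-hermitian form $\langle\ ,\ \rangle$, $\epsilon=\pm1$: it is $E$-linear in the first variable, and $\langle v,w\rangle=\epsilon\,\tau(\langle w,v\rangle)$ for all $v,w\in V$. Let $$\mathrm{U}(V)=\{g\in\mathrm{Aut}_E(V):\langle gv,gv'\rangle=\langle v,v'\rangle\ \ \forall\, v,v'\in V\},$$ $$\mathrm{GU}(V)=\{g\in\mathrm{Aut}_E(V):\text{for some scalar }\beta\in E,\ \langle gv,gv'\rangle=\beta\langle v,v'\rangle\ \ \forall\, v,v'\in V\},$$ and for $g\in\mathrm{GU}(V)$ write $\mu(g)=\beta$ for the multiplier of $g$ (if $V=0$, any nonzero scalar may be used). Let $h\in\mathrm{Aut}_F(V)$ be an anti-unitary involution, that is, $h^2=1$ and $\langle hv,hv'\rangle=\langle v',v\rangle$ for all $v,v'\in V$. For $a\in\mathrm{GU}(V)$ put $$\theta(a)=\mu(a)\,h\,a^{-1}h^{-1}.$$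 This is again an element of $\mathrm{GU}(V)$, and it lies in $\mathrm{U}(V)$ if $a\in\mathrm{U}(V)$. Then for each $a\in\mathrm{GU}(V)$ there is an $x\in\mathrm{U}(V)$ with $\theta(x)=x$ such that $x a x^{-1}=\theta(a)$. In particular, for $G=\mathrm{GU}(V)$ and also for $G=\mathrm{U}(V)$ (with $\theta$ restricted to $\mathrm{U}(V)$), for each $a\in G$ there is an $x\in G$ with $\theta(x)=x$ such that $xax^{-1}=\theta(a)$. -/

import Mathlib

/-- `B` is `ε`-hermitian with respect to `τ`: `⟨v, w⟩ = ε τ(⟨w, v⟩)`. -/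
def IsEpsHermitian {F E V : Type*} [Field F] [Field E] [Algebra F E] [AddCommGroup V] [Module E V]
    {τ : E ≃ₐ[F] E} (B : V →ₗ[E] V →ₛₗ[(τ : E →+* E)] E) (ε : E) : Prop :=
  ∀ v w : V, B v w = ε * τ (B w v)

/-- The group `U(V)` of isometries of the form `B`. -/
def isometryGroup {F E V : Type*} [Field F] [Field E] [Algebra F E] [AddCommGroup V] [Module E V]
    {τ : E ≃ₐ[F] E} (B : V →ₗ[E] V →ₛₗ[(τ : E →+* E)] E) : Subgroup (V ≃ₗ[E] V) where
  carrier := {g | ∀ v v' : V, B (g v) (g v') = B v v'}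
  one_mem' := fun _ _ => rfl
  mul_mem' := by
    intro a b ha hb v v'
    exact (ha (b v) (b v')).trans (hb v v')
  inv_mem' := by
    intro a ha v v'
    have h1 := ha (a.symm v) (a.symm v')
    rw [a.apply_symm_apply, a.apply_symm_apply] at h1
    exact h1.symm

/-- The group `GU(V)` of similitudes of the form `B`. -/
def similitudeGroup {F E V : Type*} [Field F] [Field E] [Algebra F E] [AddCommGroup V] [Module E V]
    {τ : E ≃ₐ[F] E} (B : V →ₗ[E] V →ₛₗ[(τ : E →+* E)] E) : Subgroup (V ≃ₗ[E] V) where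
  carrier := {g | ∃ β : E, ∀ v v' : V, B (g v) (g v') = β * B v v'}
  one_mem' := ⟨1, fun _ _ => (one_mul _).symm⟩
  mul_mem' := by
    rintro a b ⟨α, ha⟩ ⟨β, hb⟩
    refine ⟨α * β, fun v v' => ?_⟩
    rw [mul_assoc, ← hb v v']
    exact ha (b v) (b v')
  inv_mem' := by
    rintro a ⟨α, ha⟩
    refine ⟨α⁻¹, fun v v' => ?_⟩
    have key : ∀ w w' : V, B w w' = α * B (a.symm w) (a.symm w') := by
      intro w w'
      have h1 := ha (a.symm w) (a.symm w')
      rwa [a.apply_symm_apply, a.apply_symm_apply] at h1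
    change B (a.symm v) (a.symm v') = α⁻¹ * B v v'
    by_cases hα : α = 0
    · have hz : ∀ w w' : V, B w w' = 0 := fun w w' => by rw [key, hα, zero_mul]
      rw [hz, hz, mul_zero]
    · rw [key v v', inv_mul_cancel_left₀ hα]

/-- Every isometry is a similitude. -/
theorem isometryGroup_le {F E V : Type*} [Field F] [Field E] [Algebra F E] [AddCommGroup V]
    [Module E V] {τ : E ≃ₐ[F] E} (B : V →ₗ[E] V →ₛₗ[(τ : E →+* E)] E) :
    isometryGroup B ≤ similitudeGroup B :=
  fun _ hg => ⟨1, fun v v' => by rw [one_mul]; exact hg v v'⟩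

/-- The scalar of a similitude can be taken to be nonzero. -/
theorem exists_multiplier {F E V : Type*} [Field F] [Field E] [Algebra F E] [AddCommGroup V]
    [Module E V] {τ : E ≃ₐ[F] E} {B : V →ₗ[E] V →ₛₗ[(τ : E →+* E)] E} (g : similitudeGroup B) :
    ∃ β : Eˣ, ∀ v v' : V, B (g.1 v) (g.1 v') = β * B v v' := by
  obtain ⟨g, α, ha⟩ := g
  by_cases hα : α = 0
  · refine ⟨1, fun v v' => ?_⟩
    have hz : ∀ w w' : V, B w w' = 0 := by
      intro w w'
      have h1 := ha (g.symm w) (g.symm w')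
      rwa [g.apply_symm_apply, g.apply_symm_apply, hα, zero_mul] at h1
    rw [hz, hz, mul_zero]
  · exact ⟨Units.mk0 α hα, ha⟩

/-- The multiplier `μ(g)` of a similitude `g`. It is the unique scalar with
`⟨g v, g v'⟩ = μ(g) ⟨v, v'⟩` as soon as `B` is not identically zero, in particular whenever `B` is
nondegenerate and `V ≠ 0`. -/
noncomputable def multiplier {F E V : Type*} [Field F] [Field E] [Algebra F E] [AddCommGroup V]
    [Module E V] {τ : E ≃ₐ[F] E} {B : V →ₗ[E] V →ₛₗ[(τ : E →+* E)] E} (g : similitudeGroup B) :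
    Eˣ :=
  Classical.choose (exists_multiplier g)

theorem multiplier_spec {F E V : Type*} [Field F] [Field E] [Algebra F E] [AddCommGroup V]
    [Module E V] {τ : E ≃ₐ[F] E} {B : V →ₗ[E] V →ₛₗ[(τ : E →+* E)] E} (g : similitudeGroup B)
    (v v' : V) : B (g.1 v) (g.1 v') = multiplier g * B v v' :=
  Classical.choose_spec (exists_multiplier g) v v'

/-- An `F`-linear automorphism `h` of `V` is anti-unitary if `⟨h v, h v'⟩ = ⟨v', v⟩`. -/
def IsAntiUnitary {F E V : Type*} [Field F] [Field E] [Algebra F E] [AddCommGroup V] [Module E V]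
    [Module F V] {τ : E ≃ₐ[F] E} (B : V →ₗ[E] V →ₛₗ[(τ : E →+* E)] E) (h : V ≃ₗ[F] V) : Prop :=
  ∀ v v' : V, B (h v) (h v') = B v' v

/-- For a nondegenerate form, an anti-unitary map is `τ`-semilinear over `E`. -/
theorem IsAntiUnitary.map_smul {F E V : Type*} [Field F] [Field E] [Algebra F E] [AddCommGroup V]
    [Module E V] [Module F V] {τ : E ≃ₐ[F] E} {B : V →ₗ[E] V →ₛₗ[(τ : E →+* E)] E}
    (hB : B.Nondegenerate) {h : V ≃ₗ[F] V} (hh : IsAntiUnitary B h) (c : E) (v : V) :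
    h (c • v) = τ c • h v := by
  rw [← sub_eq_zero]
  refine hB.1 _ fun y => ?_
  obtain ⟨w, rfl⟩ := h.surjective y
  rw [map_sub, LinearMap.sub_apply, hh, LinearMap.map_smulₛₗ, LinearMap.map_smul,
    LinearMap.smul_apply, hh]
  exact sub_self _

theorem IsAntiUnitary.symm_map_smul {F E V : Type*} [Field F] [Field E] [Algebra F E]
    [AddCommGroup V] [Module E V] [Module F V] {τ : E ≃ₐ[F] E}
    {B : V →ₗ[E] V →ₛₗ[(τ : E →+* E)] E} (hB : B.Nondegenerate) {h : V ≃ₗ[F] V}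
    (hh : IsAntiUnitary B h) (c : E) (v : V) : h.symm (c • v) = τ.symm c • h.symm v := by
  apply h.injective
  rw [hh.map_smul hB, h.apply_symm_apply, h.apply_symm_apply, τ.apply_symm_apply]

/-- The conjugate `h g h⁻¹` of `g ∈ Aut_E(V)` by an anti-unitary `h ∈ Aut_F(V)`; it is again
`E`-linear. -/
def antiUnitaryConj {F E V : Type*} [Field F] [Field E] [Algebra F E] [AddCommGroup V]
    [Module E V] [Module F V] {τ : E ≃ₐ[F] E} {B : V →ₗ[E] V →ₛₗ[(τ : E →+* E)] E}
    (hB : B.Nondegenerate) {h : V ≃ₗ[F] V} (hh : IsAntiUnitary B h) (g : V ≃ₗ[E] V) :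
    V ≃ₗ[E] V where
  toFun v := h (g (h.symm v))
  map_add' := fun v w => by simp only [map_add]
  map_smul' := fun c v => by
    rw [hh.symm_map_smul hB, g.map_smul, hh.map_smul hB, τ.apply_symm_apply, RingHom.id_apply]
  invFun v := h (g.symm (h.symm v))
  left_inv := fun v => by simp only [LinearEquiv.symm_apply_apply, LinearEquiv.apply_symm_apply]
  right_inv := fun v => by simp only [LinearEquiv.symm_apply_apply, LinearEquiv.apply_symm_apply]

theorem form_smul_antiUnitaryConj {F E V : Type*} [Field F] [Field E] [Algebra F E]
    [AddCommGroup V] [Module E V] [Module F V] {τ : E ≃ₐ[F] E}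
    {B : V →ₗ[E] V →ₛₗ[(τ : E →+* E)] E} (hB : B.Nondegenerate) {h : V ≃ₗ[F] V}
    (hh : IsAntiUnitary B h) (c : Eˣ) (g : V ≃ₗ[E] V) (β : E)
    (hg : ∀ v v' : V, B (g v) (g v') = β * B v v') (v v' : V) :
    B ((LinearEquiv.smulOfUnit c * antiUnitaryConj hB hh g : V ≃ₗ[E] V) v)
      ((LinearEquiv.smulOfUnit c * antiUnitaryConj hB hh g : V ≃ₗ[E] V) v') = c * τ c * β * B v v' := by
  have e : ∀ u : V, (LinearEquiv.smulOfUnit c * antiUnitaryConj hB hh g : V ≃ₗ[E] V) u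
      = (c : E) • h (g (h.symm u)) := fun _ => rfl
  have e2 := hh (h.symm v') (h.symm v)
  rw [h.apply_symm_apply, h.apply_symm_apply] at e2
  rw [e, e, LinearMap.map_smul, LinearMap.smul_apply, LinearMap.map_smulₛₗ, hh, hg]
  rw [smul_eq_mul, smul_eq_mul]
  have e3 := hh (h.symm v) (h.symm v')
  rw [h.apply_symm_apply, h.apply_symm_apply] at e3
  rw [e3]
  change (c : E) * (τ c * _) = _
  ring

/-- The map `θ : GU(V) → GU(V)`, `θ(a) = μ(a) h a⁻¹ h⁻¹`, attached to an anti-unitary `h`. -/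
noncomputable def theta {F E V : Type*} [Field F] [Field E] [Algebra F E] [AddCommGroup V]
    [Module E V] [Module F V] {τ : E ≃ₐ[F] E} {B : V →ₗ[E] V →ₛₗ[(τ : E →+* E)] E}
    (hB : B.Nondegenerate) {h : V ≃ₗ[F] V} (hh : IsAntiUnitary B h) (a : similitudeGroup B) :
    similitudeGroup B :=
  ⟨LinearEquiv.smulOfUnit (multiplier a) * antiUnitaryConj hB hh (a.1)⁻¹,
    ⟨_, form_smul_antiUnitaryConj hB hh (multiplier a) (a⁻¹).1 _ (multiplier_spec a⁻¹)⟩⟩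

/-- The restriction `θ : U(V) → U(V)`. -/
noncomputable def thetaU {F E V : Type*} [Field F] [Field E] [Algebra F E] [AddCommGroup V]
    [Module E V] [Module F V] {τ : E ≃ₐ[F] E} {B : V →ₗ[E] V →ₛₗ[(τ : E →+* E)] E}
    (hB : B.Nondegenerate) {h : V ≃ₗ[F] V} (hh : IsAntiUnitary B h) (a : isometryGroup B) :
    isometryGroup B :=
  ⟨(theta hB hh ⟨a.1, isometryGroup_le B a.2⟩).1, by
    intro v v'
    have h1 := form_smul_antiUnitaryConj hB hh (multiplier ⟨a.1, isometryGroup_le B a.2⟩)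
      (a⁻¹).1 1 (fun v v' => by rw [one_mul]; exact (a⁻¹).2 v v') v v'
    refine h1.trans ?_
    by_cases hv : B v v' = 0
    · rw [hv, mul_zero]
    · have h2 := multiplier_spec ⟨a.1, isometryGroup_le B a.2⟩ v v'
      have h3 : ((multiplier ⟨a.1, isometryGroup_le B a.2⟩ : Eˣ) : E) = 1 :=
        mul_right_cancel₀ hv (h2.symm.trans ((a.2 v v').trans (one_mul _).symm))
      rw [h3, map_one, mul_one, mul_one, one_mul]⟩

/-! It suffices to find a `τ`-semilinear involution `k` with `B (k x) (k y) = B y x` and `k a k⁻¹ =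
μ a⁻¹`. Then `x = h k` is a linear isometry, `θ(x) = h k⁻¹ h⁻¹ h h⁻¹ = h k = x`, and `x a x⁻¹ = μ h
a⁻¹ h⁻¹ = θ(a)`.

To build `k`, let `R = K[a]`, a finite-dimensional principal algebra. Taking adjoints is an
involution `σ` of `R` with `σ a = μ a⁻¹`, so `k` only has to be `σ`-semilinear and reverse the form
(`exists_involution`). By induction on dimension it suffices to split off a nonzero nondegenerate
submodule on which such a `k` exists. On a cyclic module `R y` take `f y ↦ σ(f) y`.

Take a vector `v` of maximal `p`-power order for a prime `p`, and pair its socle vector nontrivially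
with some `w` killed by a power of `σ p`. If `p ∤ σ p`, then `v + w` generates a nondegenerate
cyclic module. If `p ∣ σ p`, either some cyclic module of this order is nondegenerate, or `v` and
`w` generate a nondegenerate module. In the last case `k` fixes `v` and sends `w` to `u w`, with `u`
supplied by duality on `R / (p ^ (m + 1))` (`exists_unitary_multiplier`). -/

/-- A module `V` over a `K`-algebra `R` with involution `σ`, together with a nondegenerate
`ε`-hermitian form `B` with values in `K` for which `σ r` acts as the adjoint of `r`. -/
structure IsHermitianModule {K R V : Type*} [Field K] [CommRing R] [Algebra K R] [AddCommGroup V]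
    [Module K V] [Module R V] (τ : K →+* K) (σ : R →+* R) (ε : K) (B : V → V → K) : Prop where
  tau_tau : ∀ c, τ (τ c) = c
  sigma_sigma : ∀ r, σ (σ r) = r
  sigma_algebraMap : ∀ c, σ (algebraMap K R c) = algebraMap K R (τ c)
  add_left : ∀ x y z, B (x + y) z = B x z + B y z
  smul_left : ∀ (c : K) x y, B (c • x) y = c * B x y
  symm : ∀ x y, B x y = ε * τ (B y x)
  adj : ∀ (r : R) x y, B (r • x) y = B x (σ r • y)
  nondeg : ∀ x, (∀ y, B x y = 0) → x = 0

namespace IsHermitianModule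

variable {K R V : Type*} [Field K] [CommRing R] [Algebra K R] [AddCommGroup V]
    [Module K V] [Module R V] {τ : K →+* K} {σ : R →+* R} {ε : K} {B : V → V → K}

/-! ### Sesquilinear algebra and representation of functionals -/

theorem add_right (H : IsHermitianModule τ σ ε B) (x y z : V) :
    B x (y + z) = B x y + B x z := by
  rw [H.symm, H.add_left, map_add, mul_add, ← H.symm, ← H.symm]

theorem zero_left (H : IsHermitianModule τ σ ε B) (y : V) : B 0 y = 0 := by
  have := H.smul_left 0 0 y
  rwa [zero_smul, zero_mul] at this

theorem zero_symm (H : IsHermitianModule τ σ ε B) {x y : V} (h : B x y = 0) : B y x = 0 := by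
  rw [H.symm, h, map_zero, mul_zero]

theorem zero_right (H : IsHermitianModule τ σ ε B) (y : V) : B y 0 = 0 :=
  H.zero_symm (H.zero_left y)

theorem smul_right (H : IsHermitianModule τ σ ε B) (c : K) (x y : V) :
    B x (c • y) = τ c * B x y := by
  rw [H.symm, H.smul_left, map_mul, mul_left_comm, ← H.symm]

theorem neg_left (H : IsHermitianModule τ σ ε B) (x y : V) : B (-x) y = -B x y := by
  rw [← neg_one_smul K x, H.smul_left, neg_one_mul]

theorem sub_left (H : IsHermitianModule τ σ ε B) (x y z : V) : B (x - y) z = B x z - B y z := by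
  rw [sub_eq_add_neg, H.add_left, H.neg_left, sub_eq_add_neg]

theorem sub_right (H : IsHermitianModule τ σ ε B) (x y z : V) : B x (y - z) = B x y - B x z := by
  rw [H.symm, H.sub_left, map_sub, mul_sub, ← H.symm, ← H.symm]

theorem adj_right (H : IsHermitianModule τ σ ε B) (r : R) (x y : V) :
    B x (r • y) = B (σ r • x) y := by
  rw [H.adj, H.sigma_sigma]

/-- Every functional is represented by the form. -/
theorem exists_repr [FiniteDimensional K V] (H : IsHermitianModule τ σ ε B) (φ : V →ₗ[K] K) :
    ∃ w, ∀ z, B z w = φ z := by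
  let j : V →+ Module.Dual K V :=
    { toFun := fun w =>
        { toFun := fun z => B z w
          map_add' := fun x y => H.add_left x y w
          map_smul' := fun c x => H.smul_left c x w }
      map_zero' := LinearMap.ext fun z => H.zero_right z
      map_add' := fun x y => LinearMap.ext fun z => H.add_right z x y }
  have hj : ∀ w, j w = 0 → w = 0 := fun w hw =>
    H.nondeg w fun y => H.zero_symm (LinearMap.congr_fun hw y)
  have hjs : ∀ (c : K) w, j (τ c • w) = c • j w := fun c w => by
    ext z
    change B z (τ c • w) = c * B z w
    rw [H.smul_right, H.tau_tau]
  let b := Module.finBasis K V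
  -- `j` is only semilinear, so surjectivity comes from counting the independent images of a basis.
  have hli : LinearIndependent K (j ∘ b) :=
    b.linearIndependent.map_of_injective_injective τ j
      (fun r hr => by rw [← H.tau_tau r, hr, map_zero]) hj hjs
  have hsp := hli.span_eq_top_of_card_eq_finrank'
    (by rw [Fintype.card_fin, Subspace.dual_finrank_eq])
  have hφ : φ ∈ Submodule.span K (Set.range (j ∘ b)) := hsp ▸ Submodule.mem_top
  suffices ∃ w, j w = φ by
    obtain ⟨w, rfl⟩ := this
    exact ⟨w, fun _ => rfl⟩
  induction hφ using Submodule.span_induction with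
  | mem x hx => obtain ⟨i, rfl⟩ := hx; exact ⟨b i, rfl⟩
  | zero => exact ⟨0, map_zero j⟩
  | add x y _ _ hx hy =>
    obtain ⟨⟨w, rfl⟩, ⟨w', rfl⟩⟩ := hx, hy
    exact ⟨w + w', map_add j w w'⟩
  | smul c x _ hx =>
    obtain ⟨w, rfl⟩ := hx
    exact ⟨τ c • w, hjs c w⟩

/-! ### Constructing and gluing involutions -/

/-- If `V` is generated by `v` and `w`, a suitable unitary multiplier `u` gives rise to the
`σ`-semilinear involution fixing `v` and sending `w` to `u • w`. -/
theorem exists_involution_of_generators (H : IsHermitianModule τ σ ε B) {v w : V} {u : R}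
    (hgen : ∀ x : V, ∃ f g : R, x = f • v + g • w)
    (hu : ∀ f : R, B (σ f • v) (u • w) = B w (f • v)) (huu : (u * σ u) • w = w) :
    ∃ k : V → V, (∀ (r : R) x, k (r • x) = σ r • k x) ∧ (∀ x, k (k x) = x) ∧
      ∀ x y, B (k x) (k y) = B y x := by
  have key : ∀ f g f' g' : R, B (σ f • v + (σ g * u) • w) (σ f' • v + (σ g' * u) • w)
      = B (f' • v + g' • w) (f • v + g • w) := by
    intro f g f' g'
    have e2 : ∀ f g : R, B (σ f • v) ((σ g * u) • w) = B (g • w) (f • v) := by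
      intro f g
      have h1 := hu (σ g * f)
      rw [map_mul, H.sigma_sigma, mul_smul, H.adj] at h1
      rw [mul_smul, h1, mul_smul, H.adj_right, H.sigma_sigma]
    have e1 : B (σ f • v) (σ f' • v) = B (f' • v) (f • v) := by
      rw [H.adj_right, H.adj_right, H.sigma_sigma, smul_smul, smul_smul, mul_comm]
    have e3 : B ((σ g * u) • w) (σ f' • v) = B (f' • v) (g • w) := by
      rw [H.symm, e2, ← H.symm]
    have e4 : B ((σ g * u) • w) ((σ g' * u) • w) = B (g' • w) (g • w) := by
      rw [H.adj_right, H.adj_right, map_mul, H.sigma_sigma, smul_smul, smul_smul,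
        show g' * σ u * (σ g * u) = σ g * g' * (u * σ u) by ring, mul_smul, huu]
    simp only [H.add_left, H.add_right, e1, e2, e3, e4]
    ring
  choose F G hFG using hgen
  have hsurj : ∀ y : V, ∃ f g : R, y = σ f • v + (σ g * u) • w := by
    intro y
    refine ⟨σ (F y), u * σ (G y), ?_⟩
    rw [map_mul, H.sigma_sigma, H.sigma_sigma,
      show σ u * G y * u = G y * (u * σ u) by ring, mul_smul, huu, ← hFG]
  -- Independence of the chosen coefficients: by `key`, the difference of two candidate values is
  -- orthogonal to everything.
  have hk : ∀ (x : V) (f g : R), x = f • v + g • w →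
      σ (F x) • v + (σ (G x) * u) • w = σ f • v + (σ g * u) • w := by
    intro x f g hx
    rw [← sub_eq_zero]
    refine H.nondeg _ fun y => ?_
    obtain ⟨f', g', rfl⟩ := hsurj y
    rw [H.sub_left, key, key, ← hx, ← hFG, sub_self]
  refine ⟨fun x => σ (F x) • v + (σ (G x) * u) • w, ?_, ?_, ?_⟩
  · intro r x
    beta_reduce
    rw [hk (r • x) (r * F x) (r * G x) (by rw [mul_smul, mul_smul, ← smul_add, ← hFG])]
    simp only [map_mul, smul_add, smul_smul, mul_assoc]
  · intro x
    beta_reduce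
    rw [hk _ _ _ rfl, map_mul, H.sigma_sigma, H.sigma_sigma,
      show G x * σ u * u = G x * (u * σ u) by ring, mul_smul, huu, ← hFG]
  · intro x y
    beta_reduce
    rw [key, ← hFG, ← hFG]

theorem restrict [IsScalarTower K R V] (H : IsHermitianModule τ σ ε B) (U : Submodule R V)
    (hU : ∀ x ∈ U, (∀ y ∈ U, B x y = 0) → x = 0) :
    IsHermitianModule τ σ ε (fun x y : U => B x y) where
  tau_tau := H.tau_tau
  sigma_sigma := H.sigma_sigma
  sigma_algebraMap := H.sigma_algebraMap
  add_left x y z := H.add_left x y z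
  smul_left c x y := H.smul_left c x y
  symm x y := H.symm x y
  adj r x y := H.adj r x y
  nondeg x hx := Subtype.ext (hU x x.2 fun y hy => hx ⟨y, hy⟩)

/-- The orthogonal complement of a submodule. -/
def orthogonal (H : IsHermitianModule τ σ ε B) (U : Submodule R V) : Submodule R V where
  carrier := {x | ∀ y ∈ U, B x y = 0}
  zero_mem' y _ := H.zero_left y
  add_mem' hx hy z hz := by rw [H.add_left, hx z hz, hy z hz, add_zero]
  smul_mem' r x hx y hy := by rw [H.adj]; exact hx _ (U.smul_mem _ hy)

/-- The functional `B · x` on `U` is represented by some `y` in `U`, and then `x - y` is orthogonal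
to `U`. -/
theorem isCompl_orthogonal [IsScalarTower K R V] [FiniteDimensional K V]
    (H : IsHermitianModule τ σ ε B) (U : Submodule R V)
    (hU : ∀ x ∈ U, (∀ y ∈ U, B x y = 0) → x = 0) : IsCompl U (H.orthogonal U) := by
  have : FiniteDimensional K U :=
    inferInstanceAs (FiniteDimensional K (U.restrictScalars K))
  refine ⟨Submodule.disjoint_def.2 fun x hx hx' => hU x hx hx', ?_⟩
  rw [codisjoint_iff, eq_top_iff]
  intro x _
  let φ : U →ₗ[K] K :=
    { toFun := fun z => B z x
      map_add' := fun y z => H.add_left y z x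
      map_smul' := fun c z => H.smul_left c z x }
  obtain ⟨y, hy⟩ := (H.restrict U hU).exists_repr φ
  refine Submodule.mem_sup.2 ⟨y, y.2, x - y, fun z hz => ?_, add_sub_cancel _ _⟩
  refine H.zero_symm ?_
  rw [H.sub_right, sub_eq_zero]
  exact (hy ⟨z, hz⟩).symm

/-- Involutions on a nondegenerate submodule and on its orthogonal complement glue. -/
theorem exists_involution_of_isCompl (H : IsHermitianModule τ σ ε B) {U : Submodule R V}
    (hc : IsCompl U (H.orthogonal U))
    (h1 : ∃ k : U → U, (∀ (r : R) x, k (r • x) = σ r • k x) ∧ (∀ x, k (k x) = x) ∧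
      ∀ x y, B (k x) (k y) = B y x)
    (h2 : ∃ k : H.orthogonal U → H.orthogonal U, (∀ (r : R) x, k (r • x) = σ r • k x) ∧
      (∀ x, k (k x) = x) ∧ ∀ x y, B (k x) (k y) = B y x) :
    ∃ k : V → V, (∀ (r : R) x, k (r • x) = σ r • k x) ∧ (∀ x, k (k x) = x) ∧
      ∀ x y, B (k x) (k y) = B y x := by
  obtain ⟨k, hks, hkk, hkB⟩ := h1
  obtain ⟨l, hls, hll, hlB⟩ := h2
  let e := Submodule.prodEquivOfIsCompl U (H.orthogonal U) hc
  have he : ∀ z, e z = (z.1 : V) + z.2 := fun z => rfl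
  have hB : ∀ z z', B (e z) (e z') = B z.1 z'.1 + B z.2 z'.2 := by
    intro z z'
    rw [he, he, H.add_left, H.add_right, H.add_right, z.2.2 _ z'.1.2,
      H.zero_symm (z'.2.2 _ z.1.2), add_zero, zero_add]
  refine ⟨fun x => e (k (e.symm x).1, l (e.symm x).2), ?_, ?_, ?_⟩
  · intro r x
    beta_reduce
    rw [map_smul, Prod.smul_fst, Prod.smul_snd, hks, hls, ← map_smul, Prod.smul_mk]
  · intro x
    beta_reduce
    rw [e.symm_apply_apply, hkk, hll, Prod.mk.eta, e.apply_symm_apply]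
  · intro x y
    beta_reduce
    rw [hB, hkB, hlB, ← hB, e.apply_symm_apply, e.apply_symm_apply]

/-! ### Arithmetic of `p`-power torsion -/

theorem exists_pow_smul_ne_zero {R V : Type*} [CommRing R] [AddCommGroup V] [Module R V] {p : R}
    {n : ℕ} {x : V} (hx : x ≠ 0) (hn : p ^ n • x = 0) :
    ∃ j, p ^ j • x ≠ 0 ∧ p ^ (j + 1) • x = 0 := by
  induction n with
  | zero => rw [pow_zero, one_smul] at hn; exact absurd hn hx
  | succ n ih =>
    by_cases h : p ^ n • x = 0
    · exact ih h
    · exact ⟨n, h, hn⟩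

/-- A non-multiple of `p` is invertible modulo powers of `p`, so `v` has annihilator exactly `(p ^
(m + 1))`. Cancelling `p ^ j` costs `j` in the exponent. -/
theorem pow_dvd_of_smul_eq_zero {R V : Type*} [CommRing R] [AddCommGroup V] [Module R V] {p : R}
    (hp : ∀ r, ¬ p ∣ r → IsCoprime r p) {m : ℕ} {v : V} (hv : p ^ (m + 1) • v = 0)
    (hv' : p ^ m • v ≠ 0) {j : ℕ} {f : R} (hf : (p ^ j * f) • v = 0) (i : ℕ)
    (hi : i + j ≤ m + 1) : p ^ i ∣ f := by
  induction i with
  | zero => rw [pow_zero]; exact one_dvd f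
  | succ i ih =>
    obtain ⟨c, rfl⟩ := ih (by omega)
    rw [pow_succ]
    refine mul_dvd_mul_left _ ?_
    by_contra hc
    obtain ⟨α, β, h1⟩ := hp c hc
    obtain ⟨d, rfl⟩ : ∃ d, m = i + j + d := ⟨m - (i + j), by omega⟩
    refine hv' ?_
    have : p ^ (i + j + d) = (α * p ^ d) * (p ^ j * (p ^ i * c)) + β * p ^ (i + j + d + 1) := by
      calc p ^ (i + j + d) = p ^ (i + j + d) * (α * c + β * p) := by rw [h1, mul_one]
        _ = _ := by ring
    rw [this, add_smul, mul_smul, hf, mul_smul β, hv, smul_zero, smul_zero, add_zero]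

/-- The socle of `R v` is generated by `p ^ m • v` and lies in every nonzero submodule of `R v`. -/
theorem exists_pow_smul_eq_smul {R V : Type*} [CommRing R] [AddCommGroup V] [Module R V] {p : R}
    (hp : ∀ r, ¬ p ∣ r → IsCoprime r p) {m : ℕ} {v : V} (hv : p ^ (m + 1) • v = 0)
    {f : R} (hf : f • v ≠ 0) : ∃ s : R, p ^ m • v = s • f • v := by
  by_cases hv' : p ^ m • v = 0
  · exact ⟨0, by rw [hv', zero_smul]⟩
  obtain ⟨j, hj, hj'⟩ := exists_pow_smul_ne_zero (p := p) (n := m + 1) hf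
    (by rw [smul_comm, hv, smul_zero])
  obtain ⟨c, hc⟩ := pow_dvd_of_smul_eq_zero hp hv hv' (j := 1) (f := p ^ j * f)
    (by rw [← mul_assoc, ← pow_add, mul_smul, add_comm, hj']) m le_rfl
  have hpc : ¬ p ∣ c := by
    rintro ⟨d, rfl⟩
    refine hj ?_
    rw [smul_smul, hc, show p ^ m * (p * d) = d * p ^ (m + 1) by ring, mul_smul, hv, smul_zero]
  obtain ⟨α, β, h1⟩ := hp c hpc
  refine ⟨α * p ^ j, ?_⟩
  have : p ^ m = α * (p ^ j * f) + β * p ^ (m + 1) := by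
    calc p ^ m = p ^ m * (α * c + β * p) := by rw [h1, mul_one]
      _ = α * (p ^ m * c) + β * p ^ (m + 1) := by ring
      _ = _ := by rw [hc]
  conv_lhs => rw [this]
  rw [add_smul, mul_smul β, hv, smul_zero, add_zero, smul_smul, mul_assoc]

/-! ### Nondegenerate submodules detected on the socle -/

/-- If `f • v` were nonzero, its multiples would include `p ^ m • v`, which would then be orthogonal
to `R w`. -/
theorem smul_eq_zero_of_orthogonal (H : IsHermitianModule τ σ ε B) {p : R}
    (hp : ∀ r, ¬ p ∣ r → IsCoprime r p) {m : ℕ} {v w : V} (hv : p ^ (m + 1) • v = 0) {r : R}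
    (hvw : B (p ^ m • v) (r • w) ≠ 0) {f : R} (hf : ∀ g : R, B (f • v) (g • w) = 0) :
    f • v = 0 := by
  by_contra h
  obtain ⟨s, hs⟩ := exists_pow_smul_eq_smul hp hv h
  refine hvw ?_
  rw [hs, H.adj, smul_smul, hf]

/-- If `B` does not vanish on the socle of the cyclic module `R v` paired with `v`, then `R v` is
nondegenerate. -/
theorem nondegenerate_span_singleton (H : IsHermitianModule τ σ ε B) {p : R}
    (hp : ∀ r, ¬ p ∣ r → IsCoprime r p) {m : ℕ} {v : V} (hv : p ^ (m + 1) • v = 0) {r : R}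
    (hvv : B (p ^ m • v) (r • v) ≠ 0) :
    ∀ x ∈ Submodule.span R {v}, (∀ y ∈ Submodule.span R {v}, B x y = 0) → x = 0 := by
  intro x hx h
  obtain ⟨f, rfl⟩ := Submodule.mem_span_singleton.1 hx
  exact H.smul_eq_zero_of_orthogonal hp hv hvv fun g => h _ (Submodule.mem_span_singleton.2 ⟨g, rfl⟩)

/-- Vectors in the primary components of two different primes exchanged by `σ`, paired
nontrivially on the socle, have a sum generating a nondegenerate cyclic module. -/
theorem nondegenerate_span_add (H : IsHermitianModule τ σ ε B) {p : R}
    (hp : ∀ r, ¬ p ∣ r → IsCoprime r p) (hσp : ¬ p ∣ σ p) {m : ℕ} {v w : V}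
    (hv : p ^ (m + 1) • v = 0) (hw : σ p ^ (m + 1) • w = 0) (hvw : B (p ^ m • v) w ≠ 0) :
    v + w ≠ 0 ∧
    ∀ x ∈ Submodule.span R {v + w}, (∀ y ∈ Submodule.span R {v + w}, B x y = 0) → x = 0 := by
  have hq : ∀ r, ¬ σ p ∣ r → IsCoprime r (σ p) := by
    intro r hr
    have h1 := (hp (σ r) fun hd => hr (by simpa [H.sigma_sigma] using map_dvd σ hd)).map σ
    rwa [H.sigma_sigma] at h1
  obtain ⟨a, b, hab⟩ := (hp _ hσp).pow (m := m + 1) (n := m + 1)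
  -- The two terms of the Bézout identity `hab` act on `R (v + w)` as the projections to the `p`-
  -- and `σ p`-primary parts.
  have hev : ∀ f : R, (a * σ p ^ (m + 1)) • f • (v + w) = f • v := by
    intro f
    have h1 : (a * σ p ^ (m + 1)) • v = v := by
      have : a * σ p ^ (m + 1) = 1 - b * p ^ (m + 1) := by rw [← hab]; ring
      rw [this, sub_smul, one_smul, mul_smul, hv, smul_zero, sub_zero]
    rw [smul_comm, smul_add, h1, mul_smul, hw, smul_zero, add_zero]
  have hew : ∀ f : R, (b * p ^ (m + 1)) • f • (v + w) = f • w := by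
    intro f
    have h1 : (b * p ^ (m + 1)) • w = w := by
      have : b * p ^ (m + 1) = 1 - a * σ p ^ (m + 1) := by rw [← hab]; ring
      rw [this, sub_smul, one_smul, mul_smul, hw, smul_zero, sub_zero]
    rw [smul_comm, smul_add, h1, mul_smul, hv, smul_zero, zero_add]
  refine ⟨fun h => hvw ?_, fun x hx h => ?_⟩
  · have := hev 1
    rw [one_smul, one_smul, h, smul_zero] at this
    rw [← this, smul_zero, H.zero_left]
  obtain ⟨f, rfl⟩ := Submodule.mem_span_singleton.1 hx
  have h' : ∀ r s : R, B (r • f • (v + w)) (s • (v + w)) = 0 := fun r s => by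
    rw [H.adj, smul_smul]
    exact h _ (Submodule.mem_span_singleton.2 ⟨_, rfl⟩)
  rw [smul_add]
  have hfv : f • v = 0 := by
    refine H.smul_eq_zero_of_orthogonal hp hv (r := 1) (w := w) (by rwa [one_smul]) fun g => ?_
    rw [← hev f, ← hew g, smul_smul (b * p ^ (m + 1))]
    exact h' _ _
  have hfw : f • w = 0 := by
    refine H.smul_eq_zero_of_orthogonal hq hw (r := 1) (w := v) (fun h0 => hvw ?_) fun g => ?_
    · rw [H.adj, map_pow, H.sigma_sigma, one_smul] at h0
      exact H.zero_symm h0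
    · rw [← hew f, ← hev g, smul_smul (a * σ p ^ (m + 1))]
      exact h' _ _
  rw [hfv, hfw, add_zero]

/-- If `B` vanishes on the socle of each cyclic module `R y` paired with `y`, two vectors paired
nontrivially on the socle generate a nondegenerate module. -/
theorem nondegenerate_span_pair (H : IsHermitianModule τ σ ε B) {p : R}
    (hp : ∀ r, ¬ p ∣ r → IsCoprime r p) {m : ℕ} {v w : V}
    (hv : p ^ (m + 1) • v = 0) (hw : p ^ (m + 1) • w = 0) (hvw : B (p ^ m • v) w ≠ 0)
    (hwv : B (p ^ m • w) v ≠ 0)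
    (hvv : ∀ r : R, B (p ^ m • v) (r • v) = 0) (hww : ∀ r : R, B (p ^ m • w) (r • w) = 0) :
    ∀ x ∈ Submodule.span R {v, w}, (∀ y ∈ Submodule.span R {v, w}, B x y = 0) → x = 0 := by
  intro x hx h
  obtain ⟨f, g, rfl⟩ := Submodule.mem_span_pair.1 hx
  have hsv : p ^ m • v ≠ 0 := fun h0 => hvw (by rw [h0, H.zero_left])
  have hsw : p ^ m • w ≠ 0 := fun h0 => hwv (by rw [h0, H.zero_left])
  -- Working with the pair gives one power `p ^ j` that carries both components into the socles
  -- without killing both; it also avoids assuming that `R v + R w` is direct.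
  suffices hfg : (f • v, g • w) = 0 by
    rw [Prod.mk_eq_zero] at hfg
    rw [hfg.1, hfg.2, add_zero]
  by_contra hne
  obtain ⟨j, hj, hj'⟩ := exists_pow_smul_ne_zero (p := p) (n := m + 1) hne
    (by rw [Prod.smul_mk, smul_comm, hv, smul_comm, hw, smul_zero, smul_zero]; rfl)
  rw [Prod.smul_mk, Prod.mk_eq_zero, smul_smul, smul_smul] at hj'
  obtain ⟨c, hc⟩ := pow_dvd_of_smul_eq_zero hp hv hsv (j := 1) (f := p ^ j * f)
    (by rw [← mul_assoc, ← pow_add, add_comm, hj'.1]) m le_rfl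
  obtain ⟨d, hd⟩ := pow_dvd_of_smul_eq_zero hp hw hsw (j := 1) (f := p ^ j * g)
    (by rw [← mul_assoc, ← pow_add, add_comm, hj'.2]) m le_rfl
  have hcd : ∀ y ∈ Submodule.span R {v, w}, B (c • p ^ m • v + d • p ^ m • w) y = 0 := by
    intro y hy
    have h1 : c • p ^ m • v + d • p ^ m • w = p ^ j • (f • v + g • w) := by
      rw [smul_add, smul_smul, smul_smul, smul_smul, smul_smul, hc, hd, mul_comm c, mul_comm d]
    rw [h1, H.adj]
    exact h _ (Submodule.smul_mem _ _ hy)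
  have hvm : ∀ r : R, r • v ∈ Submodule.span R {v, w} := fun r =>
    Submodule.smul_mem _ _ (Submodule.subset_span (by simp))
  have hwm : ∀ r : R, r • w ∈ Submodule.span R {v, w} := fun r =>
    Submodule.smul_mem _ _ (Submodule.subset_span (by simp))
  -- a coefficient coprime to `p` contradicts the nontriviality of the pairing
  have aux : ∀ (c : R) (x y : V), p ^ (m + 1) • x = 0 → B (p ^ m • x) y ≠ 0 →
      (∀ r : R, B (c • p ^ m • x) (r • y) = 0) → c • p ^ m • x = 0 := by
    intro c x y hx hxy hc
    by_contra h0
    have hpc : ¬ p ∣ c := by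
      rintro ⟨b, rfl⟩
      refine h0 ?_
      rw [smul_smul, show p * b * p ^ m = b * p ^ (m + 1) by ring, mul_smul, hx, smul_zero]
    obtain ⟨α, β, h1⟩ := hp c hpc
    refine hxy ?_
    have : p ^ m • x = α • c • p ^ m • x := by
      have h2 : p ^ m = α * (c * p ^ m) + β * p ^ (m + 1) := by
        calc p ^ m = p ^ m * (α * c + β * p) := by rw [h1, mul_one]
          _ = _ := by ring
      conv_lhs => rw [h2]
      rw [add_smul, mul_smul β, hx, smul_zero, add_zero, mul_smul, mul_smul]
    rw [this, H.adj, hc]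
  have hcv := aux c v w hv hvw fun r => by
    have h1 := hcd _ (hwm r)
    rwa [H.add_left, H.adj d, smul_smul (σ d), hww, add_zero] at h1
  have hdw := aux d w v hw hwv fun r => by
    have h1 := hcd _ (hvm r)
    rwa [H.add_left, H.adj c, smul_smul (σ c), hvv, zero_add] at h1
  refine hj ?_
  rw [Prod.smul_mk, smul_smul, smul_smul, hc, hd, mul_comm, mul_smul, hcv, mul_comm, mul_smul, hdw]
  rfl

/-- The multiplier needed to define the involution on the module generated by a pair. -/
theorem exists_unitary_multiplier [IsScalarTower K R V] [FiniteDimensional K R]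
    (H : IsHermitianModule τ σ ε B) {p : R}
    (hp : ∀ r, ¬ p ∣ r → IsCoprime r p) (hσp : p ∣ σ p) {m : ℕ} {v w : V}
    (hv : p ^ (m + 1) • v = 0) (hw : p ^ (m + 1) • w = 0) (hvw : B (p ^ m • v) w ≠ 0)
    (hwv : B (p ^ m • w) v ≠ 0) :
    ∃ u : R, (∀ f : R, B (σ f • v) (u • w) = B w (f • v)) ∧ (u * σ u) • w = w := by
  let I : Ideal R := Ideal.span {p ^ (m + 1)}
  have hIv : ∀ r ∈ I, r • v = 0 := by
    intro r hr
    obtain ⟨c, rfl⟩ := Ideal.mem_span_singleton.1 hr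
    rw [mul_comm, mul_smul, hv, smul_zero]
  have hIσ : ∀ r ∈ I, σ r ∈ I := by
    intro r hr
    refine Ideal.mem_span_singleton.2 ?_
    have h1 := map_dvd σ (Ideal.mem_span_singleton.1 hr)
    rw [map_pow] at h1
    exact (pow_dvd_pow_of_dvd hσp _).trans h1
  have hsv : p ^ m • v ≠ 0 := fun h0 => hvw (by rw [h0, H.zero_left])
  have hvI : ∀ r : R, r • v = 0 → r ∈ I := fun r hr =>
    Ideal.mem_span_singleton.2
      (pow_dvd_of_smul_eq_zero hp hv hsv (j := 0) (by rwa [pow_zero, one_mul]) _ le_rfl)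
  let lam : R →ₗ[K] K :=
    { toFun := fun f => B (f • v) w
      map_add' := fun f g => by rw [add_smul, H.add_left]
      map_smul' := fun c f => by rw [smul_assoc, H.smul_left]; rfl }
  let rho : R →ₗ[K] K :=
    { toFun := fun f => B w (σ f • v)
      map_add' := fun f g => by rw [map_add, add_smul, H.add_right]
      map_smul' := fun c f => by
        rw [Algebra.smul_def, map_mul, H.sigma_algebraMap, mul_smul, algebraMap_smul,
          H.smul_right, H.tau_tau]
        rfl }
  have hlam : ∀ r ∈ I, lam r = 0 := fun r hr => by
    change B (r • v) w = 0
    rw [hIv r hr, H.zero_left]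
  have hrho : ∀ r ∈ I, rho r = 0 := fun r hr => by
    change B w (σ r • v) = 0
    rw [hIv _ (hIσ r hr), H.zero_right]
  let J : Submodule K R := I.restrictScalars K
  let lam' : (R ⧸ J) →ₗ[K] K := J.liftQ lam hlam
  -- The multiplication pairing `(r, f) ↦ lam (r * f)` on `R / (p ^ (m + 1))`. It is nondegenerate
  -- because `lam` is nonzero on the socle, so every functional on the quotient, `rho` in
  -- particular, has the form `lam (s * ·)`.
  let Φ : (R ⧸ J) →ₗ[K] Module.Dual K (R ⧸ J) :=
    J.liftQ
      { toFun := fun r => J.liftQ (lam ∘ₗ LinearMap.mulLeft K r)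
          (fun f hf => hlam _ (I.mul_mem_left r hf))
        map_add' := fun r s => by
          ext f
          change lam ((r + s) * f) = lam (r * f) + lam (s * f)
          rw [add_mul, map_add]
        map_smul' := fun c r => by
          ext f
          change lam ((c • r) * f) = c • lam (r * f)
          rw [smul_mul_assoc, map_smul] }
      (fun r hr => by
        ext f
        exact hlam _ (I.mul_mem_right f hr))
  have hΦ : ∀ r f : R, Φ (J.mkQ r) (J.mkQ f) = lam (r * f) := fun r f => rfl
  have hinj : Function.Injective Φ := by
    rw [← LinearMap.ker_eq_bot, LinearMap.ker_eq_bot']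
    intro x hx
    obtain ⟨r, rfl⟩ := J.mkQ_surjective x
    rw [Submodule.mkQ_apply, Submodule.Quotient.mk_eq_zero]
    refine hvI r (H.smul_eq_zero_of_orthogonal hp hv (r := 1) (w := w) (by rwa [one_smul]) ?_)
    intro g
    rw [H.adj_right, smul_smul, mul_comm]
    change lam (r * σ g) = 0
    rw [← hΦ, hx, LinearMap.zero_apply]
  have hsurj : Function.Surjective Φ :=
    (LinearMap.injective_iff_surjective_of_finrank_eq_finrank
      Subspace.dual_finrank_eq.symm).1 hinj
  obtain ⟨t, ht⟩ := hsurj (J.liftQ rho hrho)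
  obtain ⟨s, rfl⟩ := J.mkQ_surjective t
  have hs : ∀ f : R, B ((s * f) • v) w = B w (σ f • v) := fun f => LinearMap.congr_fun ht (J.mkQ f)
  have hu : ∀ f : R, B (σ f • v) (σ s • w) = B w (f • v) := by
    intro f
    rw [H.adj_right, H.sigma_sigma, smul_smul, hs, H.sigma_sigma]
  refine ⟨σ s, hu, ?_⟩
  rw [H.sigma_sigma, ← sub_eq_zero]
  have h1 : (σ s * s) • w - w = (σ s * s - 1) • w := by rw [sub_smul, one_smul]
  rw [h1]
  -- Unitarity of `u = σ s`: using the defining relation twice shows that `(σ s * s - 1) • w` is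
  -- orthogonal to `R v`.
  refine H.smul_eq_zero_of_orthogonal hp hw (r := 1) (w := v) (by rwa [one_smul]) fun f => ?_
  rw [← h1, H.sub_left, sub_eq_zero]
  have h2 := hu (s * σ f)
  have h3 := hs (σ f)
  rw [map_mul, H.sigma_sigma] at h2
  rw [H.sigma_sigma] at h3
  rw [mul_comm, mul_smul, H.adj, smul_smul, H.symm, h2, ← H.symm, h3]

/-! ### Existence of a nondegenerate summand -/

/-- A nonzero module has a nonzero primary component, of some exponent `m + 1`. -/
theorem exists_primary_component (K : Type*) {R V : Type*} [Field K] [CommRing R] [Algebra K R]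
    [AddCommGroup V] [Module K V] [Module R V] [IsScalarTower K R V] [IsPrincipalIdealRing R]
    [FiniteDimensional K R] [FiniteDimensional K V] [Nontrivial V] :
    ∃ (p : R) (m : ℕ) (v : V), (∀ r, ¬ p ∣ r → IsCoprime r p) ∧ p ^ (m + 1) • v = 0 ∧
      p ^ m • v ≠ 0 ∧ ∀ x : V, p ^ (m + 2) • x = 0 → p ^ (m + 1) • x = 0 := by
  have : IsArtinianRing R := isArtinian_of_tower K inferInstance
  have : IsNoetherian R V := isNoetherian_of_tower K inferInstance
  have : IsAtomic (Submodule R V) := by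
    have : IsArtinian R V := isArtinian_of_tower K inferInstance
    infer_instance
  obtain ⟨S, hS, -⟩ := (eq_bot_or_exists_atom_le (⊤ : Submodule R V)).resolve_left top_ne_bot
  obtain ⟨x, hxS, hx⟩ := (Submodule.ne_bot_iff S).1 hS.1
  -- The annihilator of a generator of a simple submodule is maximal; `p` generates it.
  obtain ⟨p, hpI⟩ := IsPrincipalIdealRing.principal (LinearMap.ker (LinearMap.toSpanSingleton R V x))
  have hI : ∀ r : R, p ∣ r ↔ r • x = 0 := by
    intro r
    rw [← Ideal.mem_span_singleton, Ideal.span, ← hpI, LinearMap.mem_ker,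
      LinearMap.toSpanSingleton_apply]
  have hp : ∀ r, ¬ p ∣ r → IsCoprime r p := by
    intro r hr
    have hrx : r • x ≠ 0 := fun h => hr ((hI r).2 h)
    have hle : Submodule.span R {r • x} ≤ S :=
      (Submodule.span_singleton_le_iff_mem _ _).2 (S.smul_mem r hxS)
    have heq := (hS.le_iff_eq (by rwa [Ne, Submodule.span_singleton_eq_bot])).1 hle
    obtain ⟨a, ha⟩ := Submodule.mem_span_singleton.1 (heq ▸ hxS)
    obtain ⟨b, hb⟩ := (hI (1 - a * r)).2 (by rw [sub_smul, one_smul, mul_smul, ha, sub_self])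
    exact ⟨a, b, by rw [mul_comm b, ← hb]; ring⟩
  have hpx : p • x = 0 := (hI p).1 dvd_rfl
  have hstab : ∃ n, ∀ y : V, p ^ (n + 1) • y = 0 → p ^ n • y = 0 := by
    let f : ℕ →o Submodule R V :=
      ⟨fun n => LinearMap.ker (LinearMap.lsmul R V (p ^ n)), by
        refine monotone_nat_of_le_succ fun n y hy => ?_
        rw [LinearMap.mem_ker, LinearMap.lsmul_apply] at hy ⊢
        rw [pow_succ', mul_smul, hy, smul_zero]⟩
    obtain ⟨n, hn⟩ := monotone_stabilizes_iff_noetherian.2 ‹IsNoetherian R V› f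
    refine ⟨n, fun y hy => ?_⟩
    have h1 : y ∈ f (n + 1) := hy
    rw [← hn (n + 1) (Nat.le_succ n)] at h1
    exact h1
  classical
  -- `m + 1` is the first exponent at which the kernels of powers of `p` stabilize; it is positive
  -- because `p` kills `x ≠ 0`.
  obtain ⟨m, hm⟩ : ∃ m, Nat.find hstab = m + 1 := by
    refine Nat.exists_eq_succ_of_ne_zero fun h0 => hx ?_
    have h1 := Nat.find_spec hstab x
    rw [h0, zero_add, pow_one, pow_zero, one_smul] at h1
    exact h1 hpx
  have hmin := Nat.find_min hstab (m := m) (by omega)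
  push Not at hmin
  obtain ⟨v, hv, hv'⟩ := hmin
  have hspec := Nat.find_spec hstab
  rw [hm] at hspec
  exact ⟨p, m, v, hp, hv, hv', hspec⟩

/-- A vector not in the image of `r` pairs nontrivially with the kernel of the adjoint of `r`. -/
theorem exists_smul_eq_zero_of_forall_ne [IsScalarTower K R V] [FiniteDimensional K V]
    (H : IsHermitianModule τ σ ε B) {r : R} {y : V} (hy : ∀ z, y ≠ r • z) :
    ∃ w, σ r • w = 0 ∧ B y w ≠ 0 := by
  let W : Submodule K V := LinearMap.range (Algebra.lsmul K K V r)
  -- Take a functional vanishing on `r V` but not at `y`, and represent it as `B · w`; then `B z (σ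
  -- r • w) = B (r • z) w = 0` for all `z`.
  obtain ⟨φ, hφy, hφ⟩ := W.exists_dual_map_eq_bot_of_notMem (x := y)
    (by rintro ⟨z, hz⟩; exact hy z hz.symm) inferInstance
  obtain ⟨w, hw⟩ := H.exists_repr φ
  refine ⟨w, H.nondeg _ fun z => H.zero_symm ?_, by rwa [hw]⟩
  rw [← H.adj, hw]
  have h1 : φ (r • z) ∈ W.map φ := ⟨r • z, ⟨z, rfl⟩, rfl⟩
  rwa [hφ] at h1

theorem exists_nondegenerate_pair [IsScalarTower K R V] [IsPrincipalIdealRing R]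
    [FiniteDimensional K R] [FiniteDimensional K V] [Nontrivial V]
    (H : IsHermitianModule τ σ ε B) :
    ∃ (v w : V) (u : R), v ≠ 0 ∧
      (∀ x ∈ Submodule.span R {v, w}, (∀ y ∈ Submodule.span R {v, w}, B x y = 0) → x = 0) ∧
      (∀ f : R, B (σ f • v) (u • w) = B w (f • v)) ∧ (u * σ u) • w = w := by
  have cyclic : ∀ y : V, y ≠ 0 →
      (∀ x ∈ Submodule.span R {y}, (∀ z ∈ Submodule.span R {y}, B x z = 0) → x = 0) →
      ∃ (v w : V) (u : R), v ≠ 0 ∧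
      (∀ x ∈ Submodule.span R {v, w}, (∀ y ∈ Submodule.span R {v, w}, B x y = 0) → x = 0) ∧
      (∀ f : R, B (σ f • v) (u • w) = B w (f • v)) ∧ (u * σ u) • w = w := by
    intro y hy h
    refine ⟨y, 0, 1, hy, ?_, fun f => ?_, smul_zero _⟩
    · rwa [Set.pair_comm, Submodule.span_insert_zero]
    · rw [smul_zero, H.zero_left, H.zero_right]
  obtain ⟨p, m, v, hp, hv, hv', hmax⟩ := exists_primary_component K (R := R) (V := V)
  -- If `p ^ m • v = p ^ (m + 1) • z`, then `p ^ (m + 2)` kills `z`, hence so does `p ^ (m + 1)` by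
  -- maximality, and `p ^ m • v = 0`.
  obtain ⟨w, hw, hvw⟩ := H.exists_smul_eq_zero_of_forall_ne (r := p ^ (m + 1)) (y := p ^ m • v)
    fun z hz => hv' (by
      rw [hz]
      refine hmax z ?_
      rw [pow_succ', mul_smul, ← hz, smul_smul, ← pow_succ', hv])
  rw [map_pow] at hw
  by_cases hσp : p ∣ σ p
  · by_cases hex : ∃ (y : V) (r : R), p ^ (m + 1) • y = 0 ∧ B (p ^ m • y) (r • y) ≠ 0
    · obtain ⟨y, r, hy, hyy⟩ := hex
      refine cyclic y (fun h0 => hyy ?_) (H.nondegenerate_span_singleton hp hy hyy)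
      rw [h0, smul_zero, H.zero_left]
    · push Not at hex
      have hpw : p ^ (m + 1) • w = 0 := by
        obtain ⟨c, hc⟩ := hσp
        have : p = σ p * σ c := by rw [← map_mul, ← hc, H.sigma_sigma]
        rw [this, mul_pow, mul_comm, mul_smul, hw, smul_zero]
      -- Polarization: `B (p ^ m • y) y` vanishes at `v`, `w` and `v + w`, so the two cross terms
      -- sum to zero.
      have hwv : B (p ^ m • w) v ≠ 0 := by
        intro h0
        refine hvw ?_
        have h1 := hex (v + w) 1 (by rw [smul_add, hv, hpw, add_zero])
        have h2 := hex v 1 hv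
        have h3 := hex w 1 hpw
        rw [one_smul] at h1 h2 h3
        rwa [smul_add, H.add_left, H.add_right, H.add_right, h2, h3, h0, zero_add, zero_add,
          add_zero] at h1
      obtain ⟨u, hu, huu⟩ := H.exists_unitary_multiplier hp hσp hv hpw hvw hwv
      exact ⟨v, w, u, fun h0 => hv' (by rw [h0, smul_zero]),
        H.nondegenerate_span_pair hp hv hpw hvw hwv (fun r => hex v r hv) fun r => hex w r hpw,
        hu, huu⟩
  · obtain ⟨h0, h⟩ := H.nondegenerate_span_add hp hσp hv hw hvw
    exact cyclic _ h0 h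

/-- On every finite-dimensional hermitian module over a principal algebra there is a
`σ`-semilinear involution reversing the form. -/
theorem exists_involution {K R : Type*} [Field K] [CommRing R] [Algebra K R]
    [IsPrincipalIdealRing R] [FiniteDimensional K R] {τ : K →+* K} {σ : R →+* R} {ε : K} (n : ℕ) :
    ∀ {V : Type*} [AddCommGroup V] [Module K V] [Module R V] [IsScalarTower K R V]
      [FiniteDimensional K V] {B : V → V → K}, Module.finrank K V = n →
      IsHermitianModule τ σ ε B →
      ∃ k : V → V, (∀ (r : R) x, k (r • x) = σ r • k x) ∧ (∀ x, k (k x) = x) ∧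
        ∀ x y, B (k x) (k y) = B y x := by
  induction n using Nat.strong_induction_on with
  | _ n ih =>
  intro V _ _ _ _ _ B hn H
  cases subsingleton_or_nontrivial V
  · exact ⟨id, fun _ _ => Subsingleton.elim _ _, fun _ => rfl,
      fun x y => by rw [id, id, Subsingleton.elim x y]⟩
  obtain ⟨v, w, u, hv0, hU, hu, huu⟩ := H.exists_nondegenerate_pair
  have hc := H.isCompl_orthogonal _ hU
  have hvU : v ∈ Submodule.span R {v, w} := Submodule.subset_span (by simp)
  have hwU : w ∈ Submodule.span R {v, w} := Submodule.subset_span (by simp)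
  refine H.exists_involution_of_isCompl hc ?_ ?_
  · refine (H.restrict _ hU).exists_involution_of_generators (v := ⟨v, hvU⟩) (w := ⟨w, hwU⟩)
      (u := u) ?_ hu (Subtype.ext huu)
    rintro ⟨x, hx⟩
    obtain ⟨f, g, h⟩ := Submodule.mem_span_pair.1 hx
    exact ⟨f, g, Subtype.ext h.symm⟩
  · have : FiniteDimensional K (H.orthogonal (Submodule.span R {v, w})) :=
      inferInstanceAs (FiniteDimensional K ((H.orthogonal _).restrictScalars K))
    refine ih _ ?_ rfl (H.restrict _ ?_)
    · rw [← hn]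
      -- The complement is proper because the split-off submodule contains `v ≠ 0`.
      refine Submodule.finrank_lt
        (s := (H.orthogonal (Submodule.span R {v, w})).restrictScalars K) fun htop => hv0 ?_
      refine Submodule.disjoint_def.1 hc.disjoint v hvU ?_
      have : v ∈ (H.orthogonal (Submodule.span R {v, w})).restrictScalars K := by
        rw [htop]; trivial
      exact this
    · intro x hx h
      refine H.nondeg x fun y => ?_
      obtain ⟨a, ha, b, hb, rfl⟩ := Submodule.mem_sup.1
        (hc.sup_eq_top ▸ Submodule.mem_top : y ∈ _ ⊔ _)
      rw [H.add_right, hx a ha, h b hb, add_zero]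

/-! ### The algebra `K[a]` with its adjoint involution -/

/-- A similitude is conjugated to a multiple of its inverse by a semilinear involution reversing
the form. -/
theorem exists_involution_of_similitude {K V : Type*} [Field K] [AddCommGroup V] [Module K V]
    [FiniteDimensional K V] [Nontrivial V] {τ : K →+* K} {ε : K} {B : V → V → K}
    (hε : ε * τ ε = 1)
    (hadd : ∀ x y z, B (x + y) z = B x z + B y z) (hsmul : ∀ (c : K) x y, B (c • x) y = c * B x y)
    (hsymm : ∀ x y, B x y = ε * τ (B y x)) (hnd : ∀ x, (∀ y, B x y = 0) → x = 0)
    (a : V ≃ₗ[K] V) (μ : Kˣ) (ha : ∀ x y, B (a x) (a y) = μ * B x y) :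
    (∀ c, τ (τ c) = c) ∧ τ μ = μ ∧ ∃ k : V → V, (∀ x y, k (x + y) = k x + k y) ∧
      (∀ (c : K) x, k (c • x) = τ c • k x) ∧ (∀ x, k (k x) = x) ∧
      (∀ x y, B (k x) (k y) = B y x) ∧ ∀ x, k (a x) = (μ : K) • a.symm (k x) := by
  have hadd' : ∀ x y z, B x (y + z) = B x y + B x z := fun x y z => by
    rw [hsymm, hadd, map_add, mul_add, ← hsymm, ← hsymm]
  have hsmul' : ∀ (c : K) x y, B x (c • y) = τ c * B x y := fun c x y => by
    rw [hsymm, hsmul, map_mul, mul_left_comm, ← hsymm]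
  obtain ⟨x₀, hx₀⟩ := exists_ne (0 : V)
  obtain ⟨y₀, hxy₀⟩ : ∃ y, B x₀ y ≠ 0 := by
    by_contra! h
    exact hx₀ (hnd _ h)
  have hττ : ∀ c, τ (τ c) = c := by
    have h1 : ∀ x y, τ (τ (B x y)) = B x y := fun x y => by
      conv_rhs => rw [hsymm, hsymm y x, map_mul, ← mul_assoc, hε, one_mul]
    intro c
    have h2 := h1 (c • x₀) y₀
    rw [hsmul, map_mul, map_mul, h1] at h2
    exact mul_right_cancel₀ hxy₀ h2
  have hμ : τ μ = μ := by
    refine mul_right_cancel₀ hxy₀ ?_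
    rw [← ha, hsymm (a x₀), ha, map_mul, mul_left_comm, ← hsymm]
  have hright : ∀ y y', (∀ x, B x y = B x y') → y = y' := by
    intro y y' h
    rw [← sub_eq_zero]
    refine hnd _ fun x => ?_
    have h0 : B x (y - y') = 0 := by
      have h1 := hadd' x (y - y') y'
      rw [sub_add_cancel, h x] at h1
      exact right_eq_add.1 h1
    rw [hsymm, h0, map_zero, mul_zero]
  let A : Module.End K V := a
  let S : Subalgebra K (Module.End K V) := Algebra.adjoin K {A}
  have hAS : A ∈ S := Algebra.self_mem_adjoin_singleton K A
  have : IsMulCommutative S := inferInstance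
  have : IsPrincipalIdealRing S := by
    let φ : Polynomial K →ₐ[K] S := Polynomial.aeval ⟨A, hAS⟩
    refine IsPrincipalIdealRing.of_surjective φ ?_
    rintro ⟨f, hf⟩
    obtain ⟨q, rfl⟩ := (Algebra.adjoin_singleton_eq_range_aeval K A).le hf
    refine ⟨q, Subtype.ext ?_⟩
    exact (Polynomial.aeval_algHom_apply S.val ⟨A, hAS⟩ q).symm
  have : FiniteDimensional K S := inferInstance
  let As : S := ⟨A, hAS⟩
  -- `μ a⁻¹`, the adjoint of `a`, lies in `K[a]`: multiplication by `a` is injective on this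
  -- finite-dimensional algebra, hence surjective.
  obtain ⟨A', hA'⟩ : ∃ A' : S, ∀ x, A'.1 x = (μ : K) • a.symm x := by
    have hinj : Function.Injective (LinearMap.mulLeft K As) := by
      intro f g hfg
      refine Subtype.ext (LinearMap.ext fun x => a.injective ?_)
      exact LinearMap.congr_fun (congrArg Subtype.val hfg) x
    obtain ⟨s, hs⟩ := LinearMap.injective_iff_surjective.1 hinj 1
    refine ⟨(μ : K) • s, fun x => ?_⟩
    have h1 : a (s.1 x) = x := LinearMap.congr_fun (congrArg Subtype.val hs) x
    change (μ : K) • s.1 x = _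
    rw [a.eq_symm_apply.2 h1]
  have hadj : ∀ f : S, ∃ g : S, ∀ x y, B (f.1 x) y = B x (g.1 y) := by
    rintro ⟨f, hf⟩
    induction hf using Algebra.adjoin_induction with
    | mem f hf =>
      obtain rfl := Set.mem_singleton_iff.1 hf
      refine ⟨A', fun x y => ?_⟩
      rw [hA', hsmul', hμ, ← ha, a.apply_symm_apply]
      rfl
    | algebraMap c =>
      refine ⟨algebraMap K S (τ c), fun x y => ?_⟩
      change B (c • x) y = B x (τ c • y)
      rw [hsmul, hsmul', hττ]
    | add f g _ _ hf hg =>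
      obtain ⟨⟨f', hf'⟩, ⟨g', hg'⟩⟩ := hf, hg
      refine ⟨f' + g', fun x y => ?_⟩
      change B (f x + g x) y = B x (f'.1 y + g'.1 y)
      rw [hadd, hadd', hf', hg']
    | mul f g _ _ hf hg =>
      obtain ⟨⟨f', hf'⟩, ⟨g', hg'⟩⟩ := hf, hg
      refine ⟨g' * f', fun x y => ?_⟩
      exact (hf' _ _).trans (hg' _ _)
  choose σ hσ using hadj
  have huniq : ∀ f g : S, (∀ x y, B (f.1 x) y = B x (g.1 y)) → σ f = g := fun f g h =>
    Subtype.ext (LinearMap.ext fun y => hright _ _ fun x => by rw [← hσ, h])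
  let σ' : S →+* S :=
    { toFun := σ
      map_one' := huniq _ _ fun _ _ => rfl
      map_mul' := fun f g => by
        -- Adjunction reverses products; commutativity of `K[a]` makes it a ring homomorphism.
        rw [mul_comm (σ f)]
        refine huniq _ _ fun x y => ?_
        exact (hσ f _ _).trans (hσ g _ _)
      map_zero' := huniq _ _ fun x y => by
        change B 0 y = B x 0
        rw [← zero_smul K (0 : V), hsmul, hsmul', map_zero, zero_mul, zero_mul]
      map_add' := fun f g => huniq _ _ fun x y => by
        change B (f.1 x + g.1 x) y = B x ((σ f).1 y + (σ g).1 y)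
        rw [hadd, hadd', hσ, hσ] }
  have H : IsHermitianModule τ σ' ε B :=
    { tau_tau := hττ
      sigma_sigma := fun f => huniq _ _ fun x y => by
        change B ((σ f).1 x) y = B x (f.1 y)
        rw [hsymm, ← hσ, ← hsymm]
      sigma_algebraMap := fun c => huniq _ _ fun x y => by
        change B (c • x) y = B x (τ c • y)
        rw [hsmul, hsmul', hττ]
      add_left := hadd
      smul_left := hsmul
      symm := hsymm
      adj := fun f => hσ f
      nondeg := hnd }
  obtain ⟨k, hks, hkk, hkB⟩ := exists_involution _ rfl H
  refine ⟨hττ, hμ, k, fun x y => ?_, fun c x => ?_, hkk, hkB, fun x => ?_⟩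
  · refine hright _ _ fun z => ?_
    rw [← hkk z, hadd', hkB, hkB, hkB, hadd]
  · have h1 := hks (algebraMap K S c) x
    rw [H.sigma_algebraMap] at h1
    exact h1
  · have h1 := hks As x
    have h2 : σ' As = A' := huniq _ _ fun x y => by
      rw [hA', hsmul', hμ, ← ha, a.apply_symm_apply]
      rfl
    rw [h2] at h1
    exact h1.trans (hA' _)

end IsHermitianModule

/-! ### Passage from `k` to `x = h k` -/

theorem mainTheorem6 {F E V : Type*}
    [Field F] [ValuativeRel F] [TopologicalSpace F] [IsNonarchimedeanLocalField F]
    (hres : Odd (ringChar (IsLocalRing.ResidueField (ValuativeRel.valuation F).integer)))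
    [Field E] [Algebra F E] [FiniteDimensional F E] (hE : Module.finrank F E ≤ 2)
    (τ : E ≃ₐ[F] E) (hτ : Subgroup.zpowers τ = ⊤)
    [AddCommGroup V] [Module E V] [FiniteDimensional E V] [Module F V] [IsScalarTower F E V]
    (ε : E) (hε : ε = 1 ∨ ε = -1)
    (B : V →ₗ[E] V →ₛₗ[(τ : E →+* E)] E) (hherm : IsEpsHermitian B ε) (hB : B.Nondegenerate)
    (h : V ≃ₗ[F] V) (hh : IsAntiUnitary B h) (hinv : ∀ v : V, h (h v) = v) :
    (∀ a : similitudeGroup B, ∃ x : similitudeGroup B,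
      x.1 ∈ isometryGroup B ∧ theta hB hh x = x ∧ x * a * x⁻¹ = theta hB hh a) ∧
    (∀ a : similitudeGroup B, ∃ x : similitudeGroup B,
      theta hB hh x = x ∧ x * a * x⁻¹ = theta hB hh a) ∧
    (∀ a : isometryGroup B, ∃ x : isometryGroup B,
      thetaU hB hh x = x ∧ x * a * x⁻¹ = thetaU hB hh a) := by
  have hε' : ε * τ ε = 1 := by
    rcases hε with rfl | rfl
    · rw [map_one, mul_one]
    · rw [map_neg, map_one, neg_mul_neg, mul_one]
  have key : ∀ a : similitudeGroup B, ∃ x : V ≃ₗ[E] V, (∀ v w, B (x v) (x w) = B v w) ∧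
      (∀ v, h (x.symm (h v)) = x v) ∧
      ∀ v, x (a.1 (x.symm v)) = (multiplier a : E) • h (a.1.symm (h v)) := by
    intro a
    cases subsingleton_or_nontrivial V
    · exact ⟨1, fun _ _ => rfl, fun _ => Subsingleton.elim _ _, fun _ => Subsingleton.elim _ _⟩
    obtain ⟨hττ, hμ, k, hkadd, hksmul, hkk, hkB, hka⟩ :=
      IsHermitianModule.exists_involution_of_similitude (τ := (τ : E →+* E)) (ε := ε)
        (B := fun v w => B v w) hε' (fun x y z => by rw [map_add, LinearMap.add_apply])
        (fun c x y => by rw [map_smul, LinearMap.smul_apply, smul_eq_mul]) hherm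
        (fun x hx => hB.1 x hx) a.1 (multiplier a) (multiplier_spec a)
    let x : V ≃ₗ[E] V :=
      { toFun := fun v => h (k v)
        map_add' := fun v w => by rw [hkadd, map_add]
        map_smul' := fun c v => by
          rw [hksmul, hh.map_smul hB]
          exact congrArg (· • h (k v)) (hττ c)
        invFun := fun v => k (h v)
        left_inv := fun v => by beta_reduce; rw [hinv, hkk]
        right_inv := fun v => by beta_reduce; rw [hkk, hinv] }
    refine ⟨x, fun v w => ?_, fun v => ?_, fun v => ?_⟩
    · change B (h (k v)) (h (k w)) = _
      rw [hh, hkB]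
    · change h (k (h (h v))) = h (k v)
      rw [hinv]
    · change h (k (a.1 (k (h v)))) = _
      rw [hka, hkk, hh.map_smul hB]
      exact congrArg (· • h (a.1.symm (h v))) hμ
  have hsymm : ∀ v, h.symm v = h v := fun v => by rw [h.symm_apply_eq, hinv]
  -- The multiplier is a chosen scalar, arbitrary when `V = 0`, so for an isometry only its action
  -- on `V` is shown to be trivial.
  have hmul1 : ∀ x : similitudeGroup B, (∀ v w, B (x.1 v) (x.1 w) = B v w) →
      ∀ v : V, (multiplier x : E) • v = v := by
    intro x hx v
    rw [← sub_eq_zero]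
    refine hB.1 _ fun w => ?_
    rw [map_sub, map_smul, LinearMap.sub_apply, LinearMap.smul_apply, smul_eq_mul,
      ← multiplier_spec, hx, sub_self]
  have key' : ∀ a : similitudeGroup B, ∃ x : similitudeGroup B,
      x.1 ∈ isometryGroup B ∧ theta hB hh x = x ∧ x * a * x⁻¹ = theta hB hh a := by
    intro a
    obtain ⟨x, hx, hhx, hxa⟩ := key a
    refine ⟨⟨x, isometryGroup_le B hx⟩, hx, Subtype.ext (LinearEquiv.ext fun v => ?_),
      Subtype.ext (LinearEquiv.ext fun v => ?_)⟩
    · change ((multiplier _ : Eˣ) : E) • h (x.symm (h.symm v)) = x v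
      rw [hmul1 _ hx, hsymm, hhx]
    · change x (a.1 (x.symm v)) = (multiplier a : E) • h (a.1.symm (h.symm v))
      rw [hsymm, hxa]
  refine ⟨key', fun a => ?_, fun a => ?_⟩
  · obtain ⟨x, -, hx⟩ := key' a
    exact ⟨x, hx⟩
  · obtain ⟨x, hxU, hx, hxa⟩ := key' ⟨a.1, isometryGroup_le B a.2⟩
    have hx' := congrArg Subtype.val hx
    have hxa' := congrArg Subtype.val hxa
    exact ⟨⟨x.1, hxU⟩, Subtype.ext hx', Subtype.ext hxa'⟩
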